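/- Let $K\ge 1$, $P_k>0$ and $\sigma_k>0$ for $1\le k\le K$, and let $\rho,\delta$ be real with $|\rho|<1$ and $\delta>0$, where either $\rho\ge 0$ or $\delta$ is an integer. Let $\alpha_0,\alpha_1,\dots,\alpha_K$ be independent circularly-symmetric complex normal $\mathcal{CN}(0,1)$ random variables and put $$h_k=\sigma_k\Big(\sqrt{1-\rho^{2(k+\delta-1)}}\,\alpha_k+\rho^{k+\delta-1}\alpha_0\Big),\quad \gamma_k=P_k|h_k|^2,\quad G=\prod_{k=1}^K(1+\gamma_k),\quad \Omega_k=P_k\sigma_k^2\big(1-\rho^{2(k+\delta-1)}\big).$$ Put $q_k=\rho^{2(k+\delta-1)}/(1-\rho^{2(k+\delta-1)})$, $w_k=q_k\big(1+\sum_{i=1}^K q_i\big)^{-1}$ and, for ${\bf l}\in\mathbb N_0^K$, $$W_{\bf l}=\Big(1+\sum_{k=1}^K q_k\Big)^{-1}\Big(\sum_{k=1}^K l_k\Big)!\,\prod_{k=1}^K\frac{w_k^{l_k}}{l_k!}.$$ These are the probabilities of the negative multinomial distribution $\mathrm{NM}(1,(w_1,\dots,w_K))$: $W_{\bf l}\ge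 0$ and $\sum_{\bf l}W_{\bf l}=1$. Let $\mathcal A_{\bf l}=\prod_{k=1}^K(1+R_{{\bf l},k})$ with independent $R_{{\bf l},k}$, Gamma distributed with shape $1+l_k$ and scale $\Omega_k$. Then $G$ and all $\mathcal A_{\bf l}$ have probability densities $f_G$, $f_{\mathcal A_{\bf l}}$, and for all real $x$ their CDFs satisfy $$F_G(x)=\int_0^x f_G(t)\,dt=\sum_{{\bf l}\in\mathbb N_0^K}W_{\bf l}\,F_{\mathcal A_{\bf l}}(x),\qquad F_{\mathcal A_{\bf l}}(x)=\int_0^x f_{\mathcal A_{\bf l}}(t)\,dt .$$ Moreover, for every $x>0$, $$F_{\mathcal A_{\bf l}}(x)=Y^{1,K}_{K+1,1}\left[\begin{array}{c}(0,1,\tfrac1{\Omega_1},1+l_1),\dots,(0,1,\tfrac1{\Omega_K},1+l_K),(1,1,0,1)\\(0,1,0,1)\end{array}\Big|\ \frac{\prod_{k=1}^K\Omega_k}{x}\right],$$ where the Mellin-Barnes integral converges absolutely along every line $\mathrm{Re}\,s=c$ with $c>0$. Here the generalized Fox H-function is $$Y^{m,n}_{p,q}\left[\begin{array}{c}(a_i,\alpha_i,A_i,\varphi_i)_{i\le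 p}\\(b_j,\beta_j,B_j,\phi_j)_{j\le q}\end{array}\Big|\ z\right]=\frac1{2\pi \mathrm i}\int_{c-\mathrm i\infty}^{c+\mathrm i\infty}\frac{\prod_{j\le m}\Xi(b_j,\beta_j,B_j,\phi_j)\prod_{i\le n}\Xi(1-a_i,-\alpha_i,A_i,\varphi_i)}{\prod_{i>n}\Xi(a_i,\alpha_i,A_i,\varphi_i)\prod_{j>m}\Xi(1-b_j,-\beta_j,B_j,\phi_j)}\,z^{-s}\,ds,$$ the line $\mathrm{Re}\,s=c$ separating the poles of the two groups of factors in the numerator, with $\Xi(a,\alpha,A,\varphi)=A^{\varphi+a+\alpha s-1}\,\Psi(\varphi,\varphi+a+\alpha s;A)$ for $A>0$, $\Xi(a,\alpha,0,\varphi)=\Gamma(\varphi+a+\alpha s-1)/\Gamma(\varphi)$ (the limit as $A\downarrow0$, continued analytically), and Tricomi's function $\Psi(a,b;z)=\frac1{\Gamma(a)}\int_0^\infty e^{-zt}t^{a-1}(1+t)^{b-a-1}\,dt$. Hence, for every real rate $\mathcal R$, the HARQ-IR outage probability $p_{out,K}=\Pr\big(\sum_{k=1}^K\log_2(1+\gamma_k)<\mathcal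 R\big)$ is $$p_{out,K}=F_G(2^{\mathcal R})=\sum_{{\bf l}\in\mathbb N_0^K}W_{\bf l}\,F_{\mathcal A_{\bf l}}(2^{\mathcal R}).$$ -/

import Mathlib

open MeasureTheory ProbabilityTheory

noncomputable section

namespace HarqIR

/-! ### Tricomi's function and the generalized Fox H-function -/

/-- Tricomi's confluent hypergeometric function `Ψ(a, b; z)` for `0 < re a`, `0 < re z`:
`Ψ(a, b; z) = Γ(a)⁻¹ ∫₀^∞ e^{-zt} t^{a-1} (1+t)^{b-a-1} dt`. -/
def tricomi (a b z : ℂ) : ℂ :=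
  (Complex.Gamma a)⁻¹ *
    ∫ t in Set.Ioi (0 : ℝ),
      Complex.exp (-z * t) * (t : ℂ) ^ (a - 1) * (1 + (t : ℂ)) ^ (b - a - 1)

/-- A parameter quadruple `(a, α, A, φ)` of the generalized Fox H-function. -/
structure FoxParam where
  a : ℝ
  α : ℝ
  A : ℝ
  φ : ℝ

/-- `Ξ(a, α, A, φ)(s) = A^{φ+a+αs-1} Ψ(φ, φ+a+αs; A)` for `A > 0`.  At `A = 0` it is the limit
of this expression as `A ↓ 0` (which exists for `re (φ+a+αs) > 1`), continued analytically, i.e.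
`Γ(φ+a+αs-1) / Γ(φ)`; in particular `Ξ(a, α, 0, 1)(s)` is the factor `Γ(a+αs)` of the ordinary
Fox H-function. -/
def foxXi (a α A φ : ℝ) (s : ℂ) : ℂ :=
  if A = 0 then Complex.Gamma (φ + a + α * s - 1) / Complex.Gamma φ
  else (A : ℂ) ^ ((φ : ℂ) + a + α * s - 1) * tricomi φ (φ + a + α * s) A

/-- The Mellin-Barnes kernel of `Y^{m,n}_{p,q}` with upper parameters `up` and lower parameters
`low`:
`∏_{j ≤ m} Ξ(b_j, β_j, B_j, ϕ_j) ∏_{i ≤ n} Ξ(1-a_i, -α_i, A_i, φ_i)` divided by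
`∏_{j > m} Ξ(1-b_j, -β_j, B_j, ϕ_j) ∏_{i > n} Ξ(a_i, α_i, A_i, φ_i)`. -/
def foxKernel (m n : ℕ) {p q : ℕ} (up : Fin p → FoxParam) (low : Fin q → FoxParam) (s : ℂ) : ℂ :=
  (∏ j : Fin q,
    if (j : ℕ) < m then foxXi (low j).a (low j).α (low j).A (low j).φ s
    else (foxXi (1 - (low j).a) (-(low j).α) (low j).A (low j).φ s)⁻¹) *
  (∏ i : Fin p,
    if (i : ℕ) < n then foxXi (1 - (up i).a) (-(up i).α) (up i).A (up i).φ s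
    else (foxXi (up i).a (up i).α (up i).A (up i).φ s)⁻¹)

/-- The line `re s = c` separates the poles of the two groups of numerator factors.  Only factors
with vanishing third parameter have poles; those of the first group have to lie to the left and
those of the second group to the right of the line (`α`, `β` being positive). -/
def FoxSeparates (m n : ℕ) {p q : ℕ} (up : Fin p → FoxParam) (low : Fin q → FoxParam)
    (c : ℝ) : Prop :=
  (∀ j : Fin q, (j : ℕ) < m → (low j).A = 0 →
    0 < (low j).φ + (low j).a + (low j).α * c - 1) ∧
  (∀ i : Fin p, (i : ℕ) < n → (up i).A = 0 →
    0 < (up i).φ + (1 - (up i).a) + (-(up i).α) * c - 1)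

/-- The generalized Fox H-function `Y^{m,n}_{p,q}[up; low | z]`, the Mellin-Barnes integral
`(2πi)⁻¹ ∫_{c-i∞}^{c+i∞} M(s) z^{-s} ds` along a separating line `re s = c`. -/
def foxY (c : ℝ) (m n : ℕ) {p q : ℕ} (up : Fin p → FoxParam) (low : Fin q → FoxParam)
    (z : ℝ) : ℂ :=
  mellinInv c (foxKernel m n up low) z

/-! ### The channel -/

/-- Parameters of the correlated Rayleigh channel with `K` transmissions: transmit powers `P_k`,
gains `σ_k`, time correlation `ρ` and feedback delay `δ`.  The index `k : Fin K` stands for the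
transmission number `k + 1`. -/
structure Channel (K : ℕ) where
  P : Fin K → ℝ
  σ : Fin K → ℝ
  ρ : ℝ
  δ : ℝ

namespace Channel

variable {K : ℕ} (C : Channel K)

/-- The correlation exponent: `k + δ - 1` for the transmission number `k`. -/
def expo (k : Fin K) : ℝ := (((k : ℕ) + 1 : ℕ) : ℝ) + C.δ - 1

/-- `Ω_k = P_k σ_k² (1 - ρ^{2(k+δ-1)})`. -/
def scale (k : Fin K) : ℝ := C.P k * C.σ k ^ 2 * (1 - C.ρ ^ (2 * C.expo k))

/-- `ρ^{2(k+δ-1)} / (1 - ρ^{2(k+δ-1)})`. -/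
def odds (k : Fin K) : ℝ := C.ρ ^ (2 * C.expo k) / (1 - C.ρ ^ (2 * C.expo k))

/-- `w_k`, the parameters of the negative multinomial distribution. -/
def w (k : Fin K) : ℝ := C.odds k * (1 + ∑ i, C.odds i)⁻¹

/-- `W_l`, the probability mass function of the negative multinomial distribution `NM(1, w)`. -/
def weight (l : Fin K → ℕ) : ℝ :=
  (1 + ∑ k, C.odds k)⁻¹ * ((∑ k, l k).factorial : ℝ) * ∏ k, C.w k ^ l k / ((l k).factorial : ℝ)

/-- The law of `A_l = ∏_k (1 + R_{l,k})` for independent `R_{l,k}` that are Gamma distributed with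
shape `1 + l_k` and scale `Ω_k` (that is, rate `1 / Ω_k`). -/
def shiftedGammaProd (l : Fin K → ℕ) : Measure ℝ :=
  (Measure.pi fun k => gammaMeasure (1 + l k) (1 / C.scale k)).map fun r => ∏ k, (1 + r k)

/-- The upper parameters `(0, 1, 1/Ω_1, 1+l_1), …, (0, 1, 1/Ω_K, 1+l_K), (1, 1, 0, 1)`. -/
def foxUp (l : Fin K → ℕ) : Fin (K + 1) → FoxParam :=
  Fin.snoc (fun k => ⟨0, 1, 1 / C.scale k, 1 + l k⟩) ⟨1, 1, 0, 1⟩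

/-- The lower parameter `(0, 1, 0, 1)`. -/
def foxLow : Fin 1 → FoxParam := fun _ => ⟨0, 1, 0, 1⟩

variable {S : Type*} (α : Fin (K + 1) → S → ℂ)

/-- The channel coefficient `h_k = σ_k (√(1 - ρ^{2(k+δ-1)}) α_k + ρ^{k+δ-1} α_0)`. -/
def coeff (k : Fin K) (ω : S) : ℂ :=
  C.σ k * ((√(1 - C.ρ ^ (2 * C.expo k)) : ℝ) * α k.succ ω + (C.ρ ^ C.expo k : ℝ) * α 0 ω)

/-- The received signal-to-noise ratio `γ_k = P_k |h_k|²`. -/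
def snr (k : Fin K) (ω : S) : ℝ := C.P k * ‖C.coeff α k ω‖ ^ 2

/-- `G = ∏_k (1 + γ_k)`. -/
def G (ω : S) : ℝ := ∏ k, (1 + C.snr α k ω)

/-- The accumulated mutual information `I_K = ∑_k log₂ (1 + γ_k)`. -/
def info (ω : S) : ℝ := ∑ k, Real.logb 2 (1 + C.snr α k ω)

/-- The outage probability `p_out,K = Pr(I_K < R)`. -/
def outage [MeasurableSpace S] (μ : Measure S) (R : ℝ) : ℝ := μ.real {ω | C.info α ω < R}

end Channel

/-- The circularly-symmetric complex normal law `CN(0, 1)`: independent real and imaginary parts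
with law `N(0, 1/2)`. -/
def stdComplexNormal : Measure ℂ :=
  ((gaussianReal 0 (1 / 2)).prod (gaussianReal 0 (1 / 2))).map fun p => (⟨p.1, p.2⟩ : ℂ)

/-- The probability density function of a law on the real line. -/
def density (ν : Measure ℝ) (x : ℝ) : ℝ := (ν.rnDeriv volume x).toReal

end HarqIR

end

open scoped ENNReal

namespace HarqIR

/-! Condition on `α 0`. Each `γ_k` is then `Ω_k‖z + v_k‖²` with `z` standard complex normal and
`‖v_k‖² = q_k‖α 0‖²`, independently over `k`. Comparing characteristic functions shows that this law
is a Poisson mixture, with mean `q_k‖α 0‖²`, of gamma laws of shape `1 + n` and scale `Ω_k`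
(`map_norm_add_sq_eq_sum`). So, given `α 0`, `G` is a mixture of the `A_l` with products of Poisson
weights. Since `‖α 0‖²` is exponential, averaging these weights gives exactly `W_l`
(`lintegral_prod_poisson`). The result is an identity of measures (`map_G_eq_sum`); the CDF series,
the total mass of the weights and the absolute continuity of `G` are read off from it.

For the Fox function, put `M = ∏ Ω_k`. As `A_l ≥ 1`, Fubini gives `M^s E[A_l^{-s}] / s` as the
Mellin transform of `z ↦ F(M / z)` for `re s > 0`. Independence splits the expectation, each `Ω_k^s
E[(1 + R_k)^{-s}]` is a Tricomi factor `Ξ`, and `1 / s = Γ(s) / Γ(s + 1)`; hence the kernel is this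
Mellin transform (`foxKernel_eq_mellin`). Inversion needs continuity of the CDF, which absolute
continuity supplies, and integrability on the line: integration by parts makes one factor
`O(1/|s|)`, the others are at most `1` in norm, and `1 / s` makes the total `O(1/|s|²)`. -/

/-! ### Characteristic functions of gamma and noncentral chi-square laws -/

open Filter Topology in
theorem integral_pow_mul_cexp_neg_mul (n : ℕ) {z : ℂ} (hz : 0 < z.re) :
    ∫ t in Set.Ioi (0 : ℝ), (t : ℂ) ^ n * Complex.exp (-z * t) = n.factorial / z ^ (n + 1) := by
  have hz0 : z ≠ 0 := by rintro rfl; simp at hz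
  have hint : ∀ n : ℕ, IntegrableOn (fun t : ℝ => (t : ℂ) ^ n * Complex.exp (-z * t))
      (Set.Ioi 0) := by
    intro n
    have h2 : IntegrableOn (fun t : ℝ => t ^ n * Real.exp (-z.re * t)) (Set.Ioi 0) := by
      have := integrableOn_rpow_mul_exp_neg_mul_rpow (p := 1) (s := n) (b := z.re)
        (by have : (0:ℝ) ≤ n := by positivity
            linarith) one_pos hz
      simpa using this
    refine Integrable.mono' h2 ?_ ?_
    · exact (by fun_prop : Continuous fun t : ℝ =>
        (t : ℂ) ^ n * Complex.exp (-z * t)).aestronglyMeasurable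
    · filter_upwards [ae_restrict_mem measurableSet_Ioi] with t ht
      rw [norm_mul, norm_pow, Complex.norm_real, Complex.norm_exp, Real.norm_of_nonneg (le_of_lt ht)]
      simp
  induction n with
  | zero =>
    have := integral_exp_mul_complex_Ioi (a := -z) (by simpa using hz) 0
    simp only [pow_zero, one_mul, this]
    simp
  | succ n ih =>
    have hd : ∀ t ∈ Set.Ici (0 : ℝ), HasDerivAt
        (fun t : ℝ => (t : ℂ) ^ (n + 1) * Complex.exp (-z * t))
        ((n + 1) * ((t : ℂ) ^ n * Complex.exp (-z * t)) -
          z * ((t : ℂ) ^ (n + 1) * Complex.exp (-z * t))) t := by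
      intro t _
      have h1 : HasDerivAt (fun t : ℂ => t ^ (n + 1) * Complex.exp (-z * t))
        ((n + 1) * ((t : ℂ) ^ n * Complex.exp (-z * t)) -
          z * ((t : ℂ) ^ (n + 1) * Complex.exp (-z * t))) t := by
        have := (hasDerivAt_pow (n + 1) (t : ℂ)).mul ((hasDerivAt_id (t : ℂ)).const_mul (-z)).cexp
        refine this.congr_deriv ?_
        simp only [id_eq, Nat.add_sub_cancel, Nat.cast_add, Nat.cast_one]
        ring
      exact h1.comp_ofReal
    have hlim : Tendsto (fun t : ℝ => (t : ℂ) ^ (n + 1) * Complex.exp (-z * t)) atTop (𝓝 0) := by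
      rw [tendsto_zero_iff_norm_tendsto_zero]
      have h3 := (tendsto_rpow_mul_exp_neg_mul_atTop_nhds_zero (n + 1 : ℕ) z.re hz)
      refine h3.congr' ?_
      filter_upwards [eventually_gt_atTop 0] with t ht
      rw [norm_mul, norm_pow, Complex.norm_real, Complex.norm_exp, Real.norm_of_nonneg (le_of_lt ht),
        Real.rpow_natCast]
      simp
    have key := integral_Ioi_of_hasDerivAt_of_tendsto' hd
      (((hint n).const_mul _).sub ((hint (n + 1)).const_mul _)) hlim
    rw [integral_sub ((hint n).const_mul _) ((hint (n + 1)).const_mul _), integral_const_mul,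
      integral_const_mul, ih] at key
    have h4 : z * ∫ t in Set.Ioi (0 : ℝ), (t : ℂ) ^ (n + 1) * Complex.exp (-z * t)
        = (n + 1) * (n.factorial / z ^ (n + 1)) := by
      simp only [Complex.ofReal_zero, ne_eq, Nat.succ_ne_zero, not_false_eq_true, zero_pow,
        zero_mul, sub_zero] at key
      linear_combination -key
    rw [← mul_right_inj' hz0, h4, Nat.factorial_succ, pow_succ z (n + 1)]
    push_cast
    field_simp

theorem integral_gammaMeasure_one_add_nat (n : ℕ) {r : ℝ} (hr : 0 < r) (f : ℝ → ℂ) :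
    ∫ x, f x ∂gammaMeasure (1 + n) r =
      r ^ (n + 1) / n.factorial *
        ∫ t in Set.Ioi (0 : ℝ), (t : ℂ) ^ n * Complex.exp (-r * t) * f t := by
  rw [gammaMeasure, integral_withDensity_eq_integral_toReal_smul
    (by unfold gammaPDF; fun_prop) (by simp [gammaPDF]), ← integral_const_mul,
    ← integral_indicator measurableSet_Ioi]
  refine integral_congr_ae ?_
  -- The gamma density is supported on `x ≥ 0` but the integral runs over `x > 0`, so the null point
  -- `0` is discarded.
  filter_upwards [compl_mem_ae_iff.2 (measure_singleton (0 : ℝ))] with x hx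
  rw [gammaPDF, ENNReal.toReal_ofReal (gammaPDFReal_nonneg (by positivity) hr x), gammaPDFReal]
  rcases lt_or_gt_of_ne (show x ≠ 0 from hx) with h | h
  · simp [h.not_ge, h.le]
  · rw [if_pos h.le, Set.indicator_of_mem (Set.mem_Ioi.2 h), add_comm (1 : ℝ),
      Real.Gamma_nat_eq_factorial, add_sub_cancel_right, Real.rpow_natCast,
      ← Nat.cast_succ, Real.rpow_natCast, Complex.real_smul, Nat.succ_eq_add_one]
    push_cast
    rw [neg_mul]
    ring

theorem charFun_gammaMeasure_one_add_nat (n : ℕ) {r : ℝ} (hr : 0 < r) (t : ℝ) :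
    charFun (gammaMeasure (1 + n) r) t = (r / (r - t * Complex.I)) ^ (n + 1) := by
  have hz : 0 < (r - t * Complex.I : ℂ).re := by simpa using hr
  rw [charFun_apply_real, integral_gammaMeasure_one_add_nat n hr]
  have : ∀ x : ℝ, (x : ℂ) ^ n * Complex.exp (-r * x) * Complex.exp (t * x * Complex.I) =
      (x : ℂ) ^ n * Complex.exp (-(r - t * Complex.I) * x) := by
    intro x
    rw [mul_assoc, ← Complex.exp_add]
    ring_nf
  simp_rw [this]
  rw [integral_pow_mul_cexp_neg_mul n hz, div_pow]
  have : (n.factorial : ℂ) ≠ 0 := by exact_mod_cast n.factorial_ne_zero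
  field_simp

/-- Variance `1/2` makes the density `π^(-1/2) exp(-x²)`, so this is a quadratic Gaussian integral.
The square root stays unsimplified because it is only used squared. -/
theorem integral_gaussianReal_cexp_sq {τ a : ℝ} :
    ∫ x, Complex.exp (τ * (x + a) ^ 2 * Complex.I) ∂gaussianReal 0 (1 / 2) =
      (√Real.pi)⁻¹ * (Real.pi / (1 - τ * Complex.I)) ^ (1 / 2 : ℂ) *
        Complex.exp (τ * a ^ 2 * Complex.I / (1 - τ * Complex.I)) := by
  have hz : (1 - τ * Complex.I : ℂ) ≠ 0 := by
    intro h
    simpa using congrArg Complex.re h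
  rw [integral_gaussianReal_eq_integral_smul (by simp)]
  have : ∀ x : ℝ, gaussianPDFReal 0 (1 / 2) x • Complex.exp (τ * (x + a) ^ 2 * Complex.I) =
      (√Real.pi)⁻¹ * Complex.exp (-(1 - τ * Complex.I) * x ^ 2 + 2 * τ * a * Complex.I * x +
        τ * a ^ 2 * Complex.I) := by
    intro x
    rw [gaussianPDFReal, Complex.real_smul]
    push_cast
    simp only [mul_assoc]
    rw [← Complex.exp_add]
    have h2 : (√2 : ℂ) ≠ 0 := by simp
    norm_num
    rw [mul_right_comm _ _ (√2 : ℂ)⁻¹, mul_inv_cancel₀ h2, one_mul]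
    ring_nf
  simp_rw [this]
  rw [integral_const_mul, integral_cexp_quadratic (by simp), ← mul_assoc, neg_neg]
  congr 2
  field_simp
  ring_nf

instance : IsProbabilityMeasure stdComplexNormal :=
  Measure.isProbabilityMeasure_map
    ((Complex.measurableEquivRealProd.symm.measurable).aemeasurable)

/-- The squared norm is a sum over two independent coordinates, so the transform factors. The two
square roots multiply to `1 / (1 - itΩ)`, and the shift enters only through `‖v‖²`. -/
theorem charFun_map_norm_add_sq (Ω : ℝ) (v : ℂ) (t : ℝ) :
    charFun (stdComplexNormal.map fun z => Ω * ‖z + v‖ ^ 2) t =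
      1 / (1 - (t * Ω : ℝ) * Complex.I) *
        Complex.exp ((t * Ω : ℝ) * (‖v‖ ^ 2 : ℝ) * Complex.I / (1 - (t * Ω : ℝ) * Complex.I)) := by
  have hz : (1 - (t * Ω : ℝ) * Complex.I : ℂ) ≠ 0 := by
    intro h
    simpa using congrArg Complex.re h
  have hm : Measurable fun p : ℝ × ℝ => (⟨p.1, p.2⟩ : ℂ) :=
    Complex.measurableEquivRealProd.symm.measurable
  rw [charFun_apply_real, integral_map (by fun_prop) (by fun_prop), stdComplexNormal,
    integral_map hm.aemeasurable (by fun_prop)]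
  have : ∀ p : ℝ × ℝ,
      Complex.exp (t * (Ω * ‖(⟨p.1, p.2⟩ : ℂ) + v‖ ^ 2 : ℝ) * Complex.I) =
      Complex.exp ((t * Ω : ℝ) * (p.1 + v.re) ^ 2 * Complex.I) *
        Complex.exp ((t * Ω : ℝ) * (p.2 + v.im) ^ 2 * Complex.I) := by
    intro p
    rw [← Complex.exp_add, Complex.sq_norm, Complex.normSq_apply]
    push_cast
    simp only [Complex.add_re, Complex.add_im]
    congr 1
    push_cast
    ring
  simp_rw [this]
  rw [integral_prod_mul (fun x : ℝ => Complex.exp ((t * Ω : ℝ) * (x + v.re) ^ 2 * Complex.I))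
    (fun x : ℝ => Complex.exp ((t * Ω : ℝ) * (x + v.im) ^ 2 * Complex.I)),
    integral_gaussianReal_cexp_sq, integral_gaussianReal_cexp_sq, mul_mul_mul_comm,
    ← Complex.exp_add]
  congr 1
  · have h1 : (Real.pi / (1 - (t * Ω : ℝ) * Complex.I) : ℂ) ≠ 0 :=
      div_ne_zero (by simp [Real.pi_ne_zero]) hz
    rw [mul_mul_mul_comm, ← Complex.cpow_add _ _ h1, ← Complex.ofReal_mul, ← mul_inv,
      Real.mul_self_sqrt Real.pi_pos.le]
    norm_num
    field_simp
  · congr 1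
    rw [Complex.sq_norm, Complex.normSq_apply]
    push_cast
    ring

/-- A scaled noncentral chi-square law with two degrees of freedom is a Poisson mixture of gamma
laws. -/
theorem map_norm_add_sq_eq_sum {Ω : ℝ} (hΩ : 0 < Ω) (v : ℂ) :
    stdComplexNormal.map (fun z => Ω * ‖z + v‖ ^ 2) =
      Measure.sum fun n : ℕ => ENNReal.ofReal
        (Real.exp (-‖v‖ ^ 2) * ((‖v‖ ^ 2) ^ n / n.factorial)) • gammaMeasure (1 + n) (1 / Ω) := by
  set m := ‖v‖ ^ 2 with hm
  have hprob : ∀ n : ℕ, IsProbabilityMeasure (gammaMeasure (1 + n) (1 / Ω)) := fun n =>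
    isProbabilityMeasure_gammaMeasure (by positivity) (by positivity)
  have hs : HasSum (fun n : ℕ => Real.exp (-m) * (m ^ n / n.factorial)) 1 := by
    have h := (NormedSpace.expSeries_div_hasSum_exp m).mul_left (Real.exp (-m))
    rwa [← Real.exp_eq_exp_ℝ, ← Real.exp_add, neg_add_cancel, Real.exp_zero] at h
  have h0 : ∀ n : ℕ, 0 ≤ Real.exp (-m) * (m ^ n / n.factorial) := fun n => by positivity
  have hfin : IsProbabilityMeasure (Measure.sum fun n : ℕ => ENNReal.ofReal
        (Real.exp (-m) * (m ^ n / n.factorial)) • gammaMeasure (1 + n) (1 / Ω)) := by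
    constructor
    rw [Measure.sum_apply _ MeasurableSet.univ]
    simp only [Measure.smul_apply, measure_univ, smul_eq_mul, mul_one]
    rw [← ENNReal.ofReal_tsum_of_nonneg h0 hs.summable, hs.tsum_eq, ENNReal.ofReal_one]
  have hprob' : IsProbabilityMeasure (stdComplexNormal.map (fun z => Ω * ‖z + v‖ ^ 2)) :=
    Measure.isProbabilityMeasure_map (by fun_prop)
  refine Measure.ext_of_charFun (funext fun t => ?_)
  have hz : (1 - (t * Ω : ℝ) * Complex.I : ℂ) ≠ 0 := by
    intro h
    simpa using congrArg Complex.re h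
  rw [charFun_map_norm_add_sq]
  have hi : Integrable (fun x : ℝ => Complex.exp (t * x * Complex.I)) (Measure.sum fun n : ℕ =>
      ENNReal.ofReal (Real.exp (-m) * (m ^ n / n.factorial)) • gammaMeasure (1 + n) (1 / Ω)) := by
    refine (integrable_const (1 : ℝ)).mono' (by fun_prop) (ae_of_all _ fun x => ?_)
    rw [← Complex.ofReal_mul, Complex.norm_exp_ofReal_mul_I]
  have hsum := hasSum_integral_measure hi
  rw [← charFun_apply_real] at hsum
  refine HasSum.unique ?_ hsum
  simp_rw [integral_smul_measure, ENNReal.toReal_ofReal (h0 _), ← charFun_apply_real]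
  simp_rw [charFun_gammaMeasure_one_add_nat _ (one_div_pos.2 hΩ)]
  have hΩ' : (Ω : ℂ) ≠ 0 := by exact_mod_cast hΩ.ne'
  set w : ℂ := 1 / (1 - (t * Ω : ℝ) * Complex.I) with hw
  have hq : ((1 / Ω : ℝ) / ((1 / Ω : ℝ) - t * Complex.I) : ℂ) = w := by
    rw [hw]
    push_cast at hz ⊢
    field_simp
  have h := (NormedSpace.expSeries_div_hasSum_exp (m * w)).mul_left (w * Complex.exp (-m))
  rw [← Complex.exp_eq_exp_ℂ, mul_assoc, ← Complex.exp_add] at h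
  -- Summing the Poisson series of `w ^ (n + 1)` gives `w exp(m(w - 1))`; here `w - 1 = itΩ w`.
  have he : -(m : ℂ) + m * w = (t * Ω : ℝ) * (m : ℝ) * Complex.I / (1 - (t * Ω : ℝ) * Complex.I) := by
    rw [hw]
    field_simp
    ring
  rw [he] at h
  refine h.congr_fun fun n => ?_
  rw [hq, Complex.real_smul]
  push_cast
  ring
-- Products of mixtures, densities and null sets
theorem prod_tsum_eq_tsum_prod {K : ℕ} (f : Fin K → ℕ → ℝ≥0∞) :
    ∏ k, ∑' n, f k n = ∑' l : Fin K → ℕ, ∏ k, f k (l k) := by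
  induction K with
  | zero => simp
  | succ K ih =>
    rw [Fin.prod_univ_succ, ih, ← (Fin.consEquiv fun _ => ℕ).tsum_eq, ENNReal.tsum_prod
      (f := fun n (l : Fin K → ℕ) => ∏ k, f k ((Fin.consEquiv fun _ => ℕ) (n, l) k)),
      ← ENNReal.tsum_mul_right]
    refine tsum_congr fun n => ?_
    rw [← ENNReal.tsum_mul_left]
    refine tsum_congr fun l => ?_
    simp [Fin.consEquiv, Fin.prod_univ_succ]

/-- A product of mixtures is the mixture of the products. -/
theorem pi_sum_smul {K : ℕ} (c : Fin K → ℕ → ℝ≥0∞) (ν : Fin K → ℕ → Measure ℝ)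
    [∀ k n, SigmaFinite (ν k n)] [∀ k, SigmaFinite (Measure.sum fun n => c k n • ν k n)] :
    Measure.pi (fun k => Measure.sum fun n => c k n • ν k n) =
      Measure.sum fun l : Fin K → ℕ => (∏ k, c k (l k)) • Measure.pi fun k => ν k (l k) := by
  refine Measure.pi_eq fun s hs => ?_
  rw [Measure.sum_apply _ (MeasurableSet.univ_pi hs)]
  simp_rw [Measure.sum_apply _ (hs _), prod_tsum_eq_tsum_prod, Measure.smul_apply, Measure.pi_pi,
    smul_eq_mul, Finset.prod_mul_distrib]

/-- A law carried by the positive half-line that has a density is the integral of the density. -/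
theorem cdf_eq_integral_density (ν : Measure ℝ) [IsProbabilityMeasure ν] (hν : ν ≪ volume)
    (h0 : ν (Set.Iic 0) = 0) (x : ℝ) : cdf ν x = ∫ t in (0 : ℝ)..x, density ν t := by
  have hset : ∀ s : Set ℝ, ∫ t in s, density ν t = ν.real s := fun s =>
    Measure.setIntegral_toReal_rnDeriv hν s
  rw [cdf_eq_real]
  rcases le_total 0 x with hx | hx
  · rw [intervalIntegral.integral_of_le hx, hset, ← Set.Iic_union_Ioc_eq_Iic hx,
      measureReal_union (Set.Iic_disjoint_Ioc le_rfl) measurableSet_Ioc,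
      measureReal_def ν (Set.Iic 0), h0]
    simp
  · rw [intervalIntegral.integral_of_ge hx, hset, measureReal_def, measureReal_def,
      measure_mono_null (Set.Iic_subset_Iic.2 hx) h0,
      measure_mono_null (Set.Ioc_subset_Iic_self) h0]
    simp

theorem gammaMeasure_absolutelyContinuous (a r : ℝ) : gammaMeasure a r ≪ volume :=
  withDensity_absolutelyContinuous _ _

theorem ae_gammaMeasure_pos (a r : ℝ) : ∀ᵐ x ∂gammaMeasure a r, 0 < x := by
  rw [gammaMeasure, ae_withDensity_iff (by unfold gammaPDF; fun_prop)]
  filter_upwards [compl_mem_ae_iff.2 (measure_singleton (0 : ℝ))] with x hx h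
  by_contra hneg
  exact h (gammaPDF_of_neg (lt_of_le_of_ne (not_lt.1 hneg) hx))

theorem volume_preimage_one_add_mul {c : ℝ} (hc : 0 < c) {s : Set ℝ}
    (hs : volume s = 0) : volume ((fun r : ℝ => (1 + r) * c) ⁻¹' s) = 0 := by
  have : (fun r : ℝ => (1 + r) * c) ⁻¹' s = (fun r => 1 + r) ⁻¹' ((fun r => r * c) ⁻¹' s) := rfl
  rw [this, measure_preimage_add, Real.volume_preimage_mul_right hc.ne', hs, mul_zero]

theorem measurable_prod_one_add (K : ℕ) : Measurable fun r : Fin K → ℝ => ∏ k, (1 + r k) := by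
  fun_prop

/-! ### The laws of the `A_l` -/

namespace Channel
variable {K : ℕ} (C : Channel K)

theorem isProbabilityMeasure_gamma (hC : ∀ k, 0 < C.scale k) (l : Fin K → ℕ) (k : Fin K) :
    IsProbabilityMeasure (gammaMeasure (1 + l k) (1 / C.scale k)) :=
  isProbabilityMeasure_gammaMeasure (by positivity) (one_div_pos.2 (hC k))

theorem isProbabilityMeasure_shiftedGammaProd (hC : ∀ k, 0 < C.scale k) (l : Fin K → ℕ) :
    IsProbabilityMeasure (C.shiftedGammaProd l) := by
  have := C.isProbabilityMeasure_gamma hC l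
  exact Measure.isProbabilityMeasure_map (measurable_prod_one_add K).aemeasurable

theorem ae_pi_gamma_pos (hC : ∀ k, 0 < C.scale k) (l : Fin K → ℕ) :
    ∀ᵐ r ∂Measure.pi fun k => gammaMeasure (1 + l k) (1 / C.scale k), ∀ k, 0 < r k := by
  have := C.isProbabilityMeasure_gamma hC l
  rw [ae_all_iff]
  exact fun k => Measure.tendsto_eval_ae_ae.eventually (ae_gammaMeasure_pos _ _)

theorem ae_shiftedGammaProd_one_le (hC : ∀ k, 0 < C.scale k) (l : Fin K → ℕ) :
    ∀ᵐ x ∂C.shiftedGammaProd l, 1 ≤ x := by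
  rw [shiftedGammaProd, ae_map_iff (measurable_prod_one_add K).aemeasurable measurableSet_Ici]
  filter_upwards [C.ae_pi_gamma_pos hC l] with r hr
  calc (1 : ℝ) = ∏ _k : Fin K, (1 : ℝ) := by simp
    _ ≤ ∏ k, (1 + r k) := Finset.prod_le_prod (by simp) fun k _ => by linarith [hr k]

/-- Freeze all factors but one: the product is then an affine function `(1 + r) * c` of a gamma
variable with `c > 0`, and such maps pull null sets back to null sets. Without any factor the law
would be a point mass at `1`. -/
theorem shiftedGammaProd_absolutelyContinuous (hK : 1 ≤ K) (hC : ∀ k, 0 < C.scale k)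
    (l : Fin K → ℕ) : C.shiftedGammaProd l ≪ volume := by
  obtain ⟨n, rfl⟩ := Nat.exists_eq_add_of_le' hK
  have := C.isProbabilityMeasure_gamma hC l
  refine Measure.AbsolutelyContinuous.mk fun s hs h0 => ?_
  rw [shiftedGammaProd, Measure.map_apply (by fun_prop) hs]
  set μ : Fin (n + 1) → Measure ℝ := fun k => gammaMeasure (1 + l k) (1 / C.scale k)
  have hmp := measurePreserving_piFinSuccAbove μ 0
  have hset : (fun r : Fin (n + 1) → ℝ => ∏ k, (1 + r k)) ⁻¹' s =
      MeasurableEquiv.piFinSuccAbove (fun _ => ℝ) 0 ⁻¹'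
        ((fun p : ℝ × (Fin n → ℝ) => (1 + p.1) * ∏ k, (1 + p.2 k)) ⁻¹' s) := by
    ext r
    simp [Fin.prod_univ_succ, Fin.tail]
  have hms : MeasurableSet ((fun p : ℝ × (Fin n → ℝ) => (1 + p.1) * ∏ k, (1 + p.2 k)) ⁻¹' s) :=
    (by fun_prop : Measurable fun p : ℝ × (Fin n → ℝ) => (1 + p.1) * ∏ k, (1 + p.2 k)) hs
  rw [hset, hmp.measure_preimage hms.nullMeasurableSet, ← Measure.prod_swap,
    Measure.map_apply measurable_swap hms, Measure.measure_prod_null (measurable_swap hms)]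
  have hpos : ∀ᵐ r ∂Measure.pi fun j => μ (Fin.succAbove 0 j), ∀ k, 0 < r k := by
    rw [ae_all_iff]
    exact fun k => Measure.tendsto_eval_ae_ae.eventually (ae_gammaMeasure_pos _ _)
  filter_upwards [hpos] with r hr
  exact gammaMeasure_absolutelyContinuous _ _ (volume_preimage_one_add_mul (c := ∏ k, (1 + r k))
    (Finset.prod_pos fun k _ => by linarith [hr k]) h0)
end Channel
-- With zero shift the Poisson mixture reduces to its term `n = 0`.
theorem map_norm_sq_stdComplexNormal :
    stdComplexNormal.map (fun z => ‖z‖ ^ 2) = gammaMeasure 1 1 := by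
  have h := map_norm_add_sq_eq_sum one_pos 0
  simp only [one_mul, add_zero] at h
  rw [h]
  ext s hs
  rw [Measure.sum_apply _ hs, tsum_eq_single 0]
  · simp
  · intro n hn
    simp [hn]

/-! ### The law of `G` as a negative multinomial mixture -/

namespace Channel
variable {K : ℕ} (C : Channel K)

theorem expo_pos (hδ : 0 < C.δ) (k : Fin K) : 0 < C.expo k := by
  have : (0 : ℝ) ≤ ((k : ℕ) : ℝ) := Nat.cast_nonneg _
  simp only [expo, Nat.cast_add, Nat.cast_one]
  linarith

/-- This is where `ρ ≥ 0` or `δ` integral matters: for a negative base and a non-integral exponent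
the real power need not obey this law. -/
theorem rpow_two_mul_expo (hρδ : 0 ≤ C.ρ ∨ ∃ d : ℕ, C.δ = d) (k : Fin K) :
    C.ρ ^ (2 * C.expo k) = (C.ρ ^ C.expo k) ^ 2 := by
  rcases hρδ with h | ⟨d, hd⟩
  · rw [mul_comm, ← Real.rpow_mul_natCast h]
    norm_num
  · have : C.expo k = ((k + d : ℕ) : ℝ) := by
      simp only [expo, hd]
      push_cast
      ring
    rw [this, show (2 : ℝ) * ((k + d : ℕ) : ℝ) = (((k + d) * 2 : ℕ) : ℝ) by push_cast; ring,
      Real.rpow_natCast, Real.rpow_natCast, pow_mul]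

theorem rpow_two_mul_expo_lt_one (hρ : |C.ρ| < 1) (hδ : 0 < C.δ) (k : Fin K) :
    C.ρ ^ (2 * C.expo k) < 1 :=
  (le_abs_self _).trans_lt <| (Real.abs_rpow_le_abs_rpow _ _).trans_lt <|
    Real.rpow_lt_one (abs_nonneg _) hρ (by linarith [C.expo_pos hδ k])

theorem scale_pos (hP : ∀ k, 0 < C.P k) (hσ : ∀ k, 0 < C.σ k) (hρ : |C.ρ| < 1) (hδ : 0 < C.δ)
    (k : Fin K) : 0 < C.scale k := by
  have := C.rpow_two_mul_expo_lt_one hρ hδ k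
  exact mul_pos (mul_pos (hP k) (pow_pos (hσ k) 2)) (by linarith)

theorem odds_nonneg (hρ : |C.ρ| < 1) (hδ : 0 < C.δ) (hρδ : 0 ≤ C.ρ ∨ ∃ d : ℕ, C.δ = d)
    (k : Fin K) : 0 ≤ C.odds k := by
  have := C.rpow_two_mul_expo_lt_one hρ hδ k
  refine div_nonneg ?_ (by linarith)
  rw [C.rpow_two_mul_expo hρδ]
  positivity

theorem weight_nonneg (hq : ∀ k, 0 ≤ C.odds k) (l : Fin K → ℕ) : 0 ≤ C.weight l := by
  have hQ : 0 ≤ ∑ k, C.odds k := Finset.sum_nonneg fun k _ => hq k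
  have hw : ∀ k, 0 ≤ C.w k := fun k => mul_nonneg (hq k) (inv_nonneg.2 (by linarith))
  exact mul_nonneg (mul_nonneg (inv_nonneg.2 (by linarith)) (by positivity))
    (Finset.prod_nonneg fun k _ => div_nonneg (pow_nonneg (hw k) _) (by positivity))

/-- The negative multinomial law is an exponential mixture of products of Poisson laws. -/
theorem lintegral_prod_poisson (hq : ∀ k, 0 ≤ C.odds k) (l : Fin K → ℕ) :
    ∫⁻ u, ∏ k, ENNReal.ofReal
      (Real.exp (-(C.odds k * u)) * ((C.odds k * u) ^ l k / (l k).factorial)) ∂gammaMeasure 1 1 =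
      ENNReal.ofReal (C.weight l) := by
  have hQ : 0 ≤ ∑ k, C.odds k := Finset.sum_nonneg fun k _ => hq k
  set Q := ∑ k, C.odds k with hQdef
  have hQ1 : 0 < 1 + Q := by linarith
  set n := ∑ k, l k with hn
  rw [gammaMeasure, lintegral_withDensity_eq_lintegral_mul _ (by unfold gammaPDF; fun_prop)
    (by fun_prop)]
  -- With `n = ∑ l_k` and `Q = ∑ q_k`, the integrand is a multiple of `u ^ n * exp(-(1 + Q)u)`, an
  -- unnormalised gamma density of shape `n + 1` and rate `1 + Q`; the multiple left after
  -- normalising is the weight.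
  have : ∀ u, (gammaPDF 1 1 * fun u => ∏ k, ENNReal.ofReal
      (Real.exp (-(C.odds k * u)) * ((C.odds k * u) ^ l k / (l k).factorial))) u =
      ENNReal.ofReal (C.weight l) * gammaPDF (n + 1) (1 + Q) u := by
    intro u
    rw [Pi.mul_apply]
    rcases lt_or_ge u 0 with hu | hu
    · simp [gammaPDF_of_neg hu]
    · have hk : ∀ k, 0 ≤ C.odds k * u := fun k => mul_nonneg (hq k) hu
      rw [gammaPDF_of_nonneg hu, gammaPDF_of_nonneg hu, ← ENNReal.ofReal_prod_of_nonneg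
        fun k _ => mul_nonneg (Real.exp_pos _).le (div_nonneg (pow_nonneg (hk k) _) (by positivity)),
        ← ENNReal.ofReal_mul (by positivity), ← ENNReal.ofReal_mul (C.weight_nonneg hq l)]
      congr 1
      rw [Finset.prod_mul_distrib, ← Real.exp_sum, Finset.sum_neg_distrib, ← Finset.sum_mul,
        ← hQdef, weight, ← hQdef, ← hn, Real.Gamma_nat_eq_factorial, add_sub_cancel_right,
        Real.rpow_natCast, ← Nat.cast_succ, Real.rpow_natCast]
      have h1 : ∏ k, (C.odds k * u) ^ l k / ((l k).factorial : ℝ) =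
          u ^ n * ∏ k, C.odds k ^ l k / ((l k).factorial : ℝ) := by
        rw [hn, ← Finset.prod_pow_eq_pow_sum, ← Finset.prod_mul_distrib]
        exact Finset.prod_congr rfl fun k _ => by rw [mul_pow]; ring
      have h2 : ∏ k, C.w k ^ l k / ((l k).factorial : ℝ) =
          ((1 + Q)⁻¹) ^ n * ∏ k, C.odds k ^ l k / ((l k).factorial : ℝ) := by
        rw [hn, ← Finset.prod_pow_eq_pow_sum, ← Finset.prod_mul_distrib]
        exact Finset.prod_congr rfl fun k _ => by rw [w, mul_pow]; ring
      have h3 : Real.exp (-((1 + Q) * u)) = Real.exp (-u) * Real.exp (-(Q * u)) := by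
        rw [← Real.exp_add]
        ring_nf
      rw [h1, h2, h3, Nat.succ_eq_add_one, inv_pow]
      have h4 : (n.factorial : ℝ) ≠ 0 := by exact_mod_cast n.factorial_ne_zero
      simp only [Real.one_rpow, Real.Gamma_one, sub_self, Real.rpow_zero, one_mul, div_one]
      field_simp
      ring
  simp_rw [this]
  rw [lintegral_const_mul _ (by unfold gammaPDF; fun_prop),
    lintegral_gammaPDF_eq_one (by positivity) hQ1, mul_one]

/-- Pulling out the coefficient of `α k.succ` exhibits `α 0` as a shift, the form needed for the
noncentral law. -/
theorem snr_eq (hρ : |C.ρ| < 1) (hδ : 0 < C.δ) {S : Type*} (α : Fin (K + 1) → S → ℂ) (k : Fin K)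
    (ω : S) : C.snr α k ω = C.scale k *
      ‖α k.succ ω + ((C.ρ ^ C.expo k / √(1 - C.ρ ^ (2 * C.expo k)) : ℝ) : ℂ) * α 0 ω‖ ^ 2 := by
  have h := C.rpow_two_mul_expo_lt_one hρ hδ k
  have hs : 0 < √(1 - C.ρ ^ (2 * C.expo k)) := Real.sqrt_pos.2 (by linarith)
  have hsq := Real.sq_sqrt (show 0 ≤ 1 - C.ρ ^ (2 * C.expo k) by linarith)
  set a := √(1 - C.ρ ^ (2 * C.expo k))
  have : C.coeff α k ω = (C.σ k * a : ℝ) *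
      (α k.succ ω + ((C.ρ ^ C.expo k / a : ℝ) : ℂ) * α 0 ω) := by
    have ha : (a : ℂ) ≠ 0 := by exact_mod_cast hs.ne'
    simp only [coeff]
    push_cast
    field_simp
    rw [mul_comm (a : ℂ)]
  rw [snr, this, norm_mul, mul_pow, Complex.norm_real, Real.norm_eq_abs, sq_abs, mul_pow, hsq,
    scale]
  ring

/-- This is the conditional law of `G` given `α 0`, with `v k` the resulting shifts: the
one-dimensional Poisson mixtures are multiplied out. -/
theorem pi_map_prod_one_add (hC : ∀ k, 0 < C.scale k) (v : Fin K → ℂ) {s : Set ℝ}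
    (hs : MeasurableSet s) :
    (Measure.pi fun _ : Fin K => stdComplexNormal)
        ((fun y => ∏ k, (1 + C.scale k * ‖y k + v k‖ ^ 2)) ⁻¹' s) =
      ∑' l : Fin K → ℕ, (∏ k, ENNReal.ofReal
        (Real.exp (-‖v k‖ ^ 2) * ((‖v k‖ ^ 2) ^ l k / (l k).factorial))) *
          C.shiftedGammaProd l s := by
  have hg : ∀ k (n : ℕ), IsProbabilityMeasure (gammaMeasure (1 + n) (1 / C.scale k)) := fun k n =>
    isProbabilityMeasure_gammaMeasure (by positivity) (one_div_pos.2 (hC k))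
  have hm : ∀ k, Measurable fun z : ℂ => C.scale k * ‖z + v k‖ ^ 2 := fun k => by fun_prop
  have hp : ∀ k, IsProbabilityMeasure
      (stdComplexNormal.map fun z : ℂ => C.scale k * ‖z + v k‖ ^ 2) :=
    fun k => Measure.isProbabilityMeasure_map (hm k).aemeasurable
  have hcomp : (fun y : Fin K → ℂ => ∏ k, (1 + C.scale k * ‖y k + v k‖ ^ 2)) =
      (fun r : Fin K → ℝ => ∏ k, (1 + r k)) ∘ fun y k => C.scale k * ‖y k + v k‖ ^ 2 := rfl
  have hmm : Measurable fun (y : Fin K → ℂ) k => C.scale k * ‖y k + v k‖ ^ 2 := by fun_prop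
  rw [hcomp, Set.preimage_comp, ← Measure.map_apply hmm (measurable_prod_one_add K hs),
    Measure.pi_map_pi fun k => (hm k).aemeasurable]
  simp_rw [fun k => map_norm_add_sq_eq_sum (hC k) (v k)] at hp ⊢
  have : ∀ k, SigmaFinite (Measure.sum fun n : ℕ => ENNReal.ofReal
      (Real.exp (-‖v k‖ ^ 2) * ((‖v k‖ ^ 2) ^ n / n.factorial)) •
        gammaMeasure (1 + n) (1 / C.scale k)) := fun k => have := hp k; inferInstance
  rw [pi_sum_smul, Measure.sum_apply _ (measurable_prod_one_add K hs)]
  refine tsum_congr fun l => ?_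
  rw [Measure.smul_apply, smul_eq_mul, shiftedGammaProd,
    Measure.map_apply (measurable_prod_one_add K) hs]

/-- The law of `G` is the negative multinomial mixture of the laws of the `A_l`. -/
theorem map_G_eq_sum (hC : ∀ k, 0 < C.scale k) (hq : ∀ k, 0 ≤ C.odds k)
    (hρ : |C.ρ| < 1) (hδ : 0 < C.δ) (hρδ : 0 ≤ C.ρ ∨ ∃ d : ℕ, C.δ = d)
    {S : Type*} [MeasurableSpace S] (μ : Measure S) [IsProbabilityMeasure μ]
    (α : Fin (K + 1) → S → ℂ) (hα : ∀ i, HasLaw (α i) stdComplexNormal μ)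
    (hind : iIndepFun α μ) :
    μ.map (C.G α) =
      Measure.sum fun l => ENNReal.ofReal (C.weight l) • C.shiftedGammaProd l := by
  set u : Fin K → ℝ := fun k => C.ρ ^ C.expo k / √(1 - C.ρ ^ (2 * C.expo k)) with hu
  have hu2 : ∀ k (z : ℂ), ‖(u k : ℂ) * z‖ ^ 2 = C.odds k * ‖z‖ ^ 2 := by
    intro k z
    have h := C.rpow_two_mul_expo_lt_one hρ hδ k
    rw [norm_mul, mul_pow, Complex.norm_real, Real.norm_eq_abs, sq_abs, hu, div_pow,
      Real.sq_sqrt (by linarith), ← C.rpow_two_mul_expo hρδ, odds]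
  have hlaw : μ.map (fun ω i => α i ω) = Measure.pi fun _ => stdComplexNormal := by
    rw [(iIndepFun_iff_map_fun_eq_pi_map fun i => (hα i).aemeasurable).1 hind]
    simp_rw [(hα _).map_eq]
  set h : ℂ × (Fin K → ℂ) → ℝ := fun p => ∏ k, (1 + C.scale k * ‖p.2 k + u k * p.1‖ ^ 2) with hh
  have hhm : Measurable h := by fun_prop
  have hG : C.G α = h ∘ MeasurableEquiv.piFinSuccAbove (fun _ => ℂ) 0 ∘ fun ω i => α i ω := by
    funext ω
    simp [G, C.snr_eq hρ hδ, hh, hu, Fin.tail]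
  have hmp := measurePreserving_piFinSuccAbove (fun _ : Fin (K + 1) => stdComplexNormal) 0
  have hαm : AEMeasurable (fun ω i => α i ω) μ := aemeasurable_pi_lambda _ fun i =>
    (hα i).aemeasurable
  ext s hs
  rw [hG, ← Function.comp_assoc, ← AEMeasurable.map_map_of_aemeasurable
    (hhm.comp (MeasurableEquiv.measurable _)).aemeasurable hαm, hlaw,
    ← Measure.map_map hhm (MeasurableEquiv.measurable _), hmp.map_eq, Measure.map_apply hhm hs,
    Measure.prod_apply (hhm hs), Measure.sum_apply _ hs]
  -- The slice at `α 0 = z`; its weights depend on `z` only through `‖z‖²`, which is exponential.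
  have hslice : ∀ z : ℂ, (Measure.pi fun _ : Fin K => stdComplexNormal) (Prod.mk z ⁻¹' (h ⁻¹' s)) =
      ∑' l : Fin K → ℕ, (∏ k, ENNReal.ofReal (Real.exp (-(C.odds k * ‖z‖ ^ 2)) *
        ((C.odds k * ‖z‖ ^ 2) ^ l k / (l k).factorial))) * C.shiftedGammaProd l s := by
    intro z
    have := C.pi_map_prod_one_add hC (fun k => u k * z) hs
    simp_rw [hu2] at this
    exact this
  simp_rw [hslice]
  rw [lintegral_tsum fun l => by fun_prop]
  refine tsum_congr fun l => ?_
  rw [lintegral_mul_const _ (by fun_prop), Measure.smul_apply, smul_eq_mul,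
    ← C.lintegral_prod_poisson hq l, ← map_norm_sq_stdComplexNormal,
    lintegral_map (by fun_prop) (by fun_prop)]

end Channel
-- Mellin transforms of CDFs and their inversion
theorem prod_ofReal_cpow {ι : Type*} (t : Finset ι) (f : ι → ℝ) (hf : ∀ i, 0 ≤ f i) (s : ℂ) :
    ((∏ i ∈ t, f i : ℝ) : ℂ) ^ s = ∏ i ∈ t, (f i : ℂ) ^ s := by
  classical
  induction t using Finset.induction_on with
  | empty => simp
  | insert a t ha ih =>
    rw [Finset.prod_insert ha, Finset.prod_insert ha, Complex.ofReal_mul,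
      Complex.mul_cpow_ofReal_nonneg (hf a) (Finset.prod_nonneg fun i _ => hf i), ih]

theorem norm_cpow_neg_le_one {a : ℝ} (ha : 1 ≤ a) {s : ℂ} (hs : 0 ≤ s.re) :
    ‖(a : ℂ) ^ (-s)‖ ≤ 1 := by
  rw [Complex.norm_cpow_eq_rpow_re_of_pos (by linarith)]
  exact Real.rpow_le_one_of_one_le_of_nonpos ha (by simpa using hs)

section Decay

open Filter Topology

/-- Integration by parts: the transform of `t ^ n * exp (-r * t)` against `(1 + t) ^ (-s)` decays
like `1 / |s|` in the right half-plane. -/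
theorem exists_norm_one_sub_mul_integral_le (n : ℕ) {r : ℝ} (hr : 0 < r) :
    ∃ D : ℝ, ∀ s : ℂ, 0 < s.re → ‖(1 - s) * ∫ t in Set.Ioi (0 : ℝ),
      (t : ℂ) ^ n * Complex.exp (-r * t) * ((1 + t : ℝ) : ℂ) ^ (-s)‖ ≤ D := by
  set u : ℝ → ℝ := fun t => t ^ n * Real.exp (-r * t) with hu
  set u' : ℝ → ℝ := fun t => (n * t ^ (n - 1) - r * t ^ n) * Real.exp (-r * t) with hu'
  have hint : ∀ m : ℕ, IntegrableOn (fun t : ℝ => t ^ m * Real.exp (-r * t)) (Set.Ioi 0) := by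
    intro m
    have := integrableOn_rpow_mul_exp_neg_mul_rpow (p := 1) (s := m) (b := r)
      (by have : (0:ℝ) ≤ m := by positivity
          linarith) one_pos hr
    simpa using this
  have hB : IntegrableOn (fun t => ‖u' t * (1 + t)‖) (Set.Ioi 0) := by
    -- The exponent `n - 1 + 1` comes from `t ^ (n - 1) * t`. It differs from `n` only at `n = 0`,
    -- where the coefficient `n` removes the term.
    have h := ((((hint (n - 1)).const_mul n).sub ((hint n).const_mul r)).add
      (((hint (n - 1 + 1)).const_mul n).sub ((hint (n + 1)).const_mul r))).norm
    refine h.congr (ae_of_all _ fun t => ?_)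
    simp only [hu', Pi.add_apply, Pi.sub_apply]
    congr 1
    ring
  -- Boundary term plus remaining integral; uniform in `s` because `‖(1 + t)^(1 - s)‖ ≤ 1 + t` for
  -- `re s > 0`.
  refine ⟨‖u 0‖ + ∫ t in Set.Ioi (0 : ℝ), ‖u' t * (1 + t)‖, fun s hs => ?_⟩
  have hnorm : ∀ t ∈ Set.Ioi (0 : ℝ), ‖((1 + t : ℝ) : ℂ) ^ (1 - s)‖ ≤ 1 + t := by
    intro t ht
    have ht' : (0 : ℝ) < t := ht
    rw [Complex.norm_cpow_eq_rpow_re_of_pos (by linarith)]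
    calc (1 + t) ^ (1 - s).re ≤ (1 + t) ^ (1 : ℝ) :=
          Real.rpow_le_rpow_of_exponent_le (by linarith) (by simpa using hs.le)
      _ = 1 + t := Real.rpow_one _
  have hcpow : ∀ w : ℂ, ContinuousOn (fun t : ℝ => ((1 + t : ℝ) : ℂ) ^ w) (Set.Ioi 0) := by
    intro w t ht
    have ht' : (0 : ℝ) < t := ht
    refine ContinuousAt.continuousWithinAt ?_
    refine ContinuousAt.cpow (by fun_prop) continuousAt_const ?_
    exact Complex.ofReal_mem_slitPlane.2 (by linarith)
  have hI1 : IntegrableOn (fun t : ℝ => (u' t : ℂ) * ((1 + t : ℝ) : ℂ) ^ (1 - s)) (Set.Ioi 0) := by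
    refine Integrable.mono' hB ?_ ?_
    · refine ContinuousOn.aestronglyMeasurable ?_ measurableSet_Ioi
      exact (by fun_prop : Continuous fun t => (u' t : ℂ)).continuousOn.mul (hcpow _)
    · filter_upwards [ae_restrict_mem measurableSet_Ioi] with t ht
      have ht' : (0 : ℝ) < t := ht
      rw [norm_mul, Complex.norm_real, norm_mul (u' t), Real.norm_of_nonneg (show 0 ≤ 1 + t by linarith)]
      exact mul_le_mul_of_nonneg_left (hnorm t ht) (norm_nonneg _)
  have hI2 : IntegrableOn (fun t : ℝ => (u t : ℂ) * ((1 + t : ℝ) : ℂ) ^ (-s)) (Set.Ioi 0) := by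
    refine Integrable.mono' (hint n) ?_ ?_
    · refine ContinuousOn.aestronglyMeasurable ?_ measurableSet_Ioi
      exact (by fun_prop : Continuous fun t => (u t : ℂ)).continuousOn.mul (hcpow _)
    · filter_upwards [ae_restrict_mem measurableSet_Ioi] with t ht
      have ht' : (0 : ℝ) < t := ht
      rw [norm_mul, Complex.norm_real, Real.norm_of_nonneg (by positivity)]
      exact mul_le_of_le_one_right (by positivity) (norm_cpow_neg_le_one (by linarith) hs.le)
  have hd : ∀ t ∈ Set.Ici (0 : ℝ), HasDerivAt
      (fun t : ℝ => (u t : ℂ) * ((1 + t : ℝ) : ℂ) ^ (1 - s))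
      ((u' t : ℂ) * ((1 + t : ℝ) : ℂ) ^ (1 - s) +
        (1 - s) * ((u t : ℂ) * ((1 + t : ℝ) : ℂ) ^ (-s))) t := by
    intro t ht
    have ht' : (0 : ℝ) ≤ t := ht
    have h1 : HasDerivAt u (u' t) t := by
      refine ((hasDerivAt_pow n t).mul ((hasDerivAt_id t).const_mul (-r)).exp).congr_deriv ?_
      simp only [hu', id_eq]
      ring
    have h2 : HasDerivAt (fun t : ℝ => ((1 + t : ℝ) : ℂ)) 1 t := by
      simpa using ((hasDerivAt_id t).const_add 1).ofReal_comp
    have h0 : HasDerivAt (fun z : ℂ => z ^ (1 - s))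
        ((1 - s) * ((1 + t : ℝ) : ℂ) ^ (1 - s - 1) * 1) ((1 + t : ℝ) : ℂ) :=
      (hasDerivAt_id _).cpow_const (Complex.ofReal_mem_slitPlane.2 (by linarith))
    have h3 := HasDerivAt.comp (h := fun t : ℝ => ((1 + t : ℝ) : ℂ)) t h0 h2
    refine (h1.ofReal_comp.mul h3).congr_deriv ?_
    rw [show 1 - s - 1 = -s by ring, Function.comp_apply]
    ring
  have hlim : Tendsto (fun t : ℝ => (u t : ℂ) * ((1 + t : ℝ) : ℂ) ^ (1 - s)) atTop (𝓝 0) := by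
    have hl : ∀ m : ℕ, Tendsto (fun t : ℝ => t ^ m * Real.exp (-r * t)) atTop (𝓝 0) := by
      intro m
      simpa using tendsto_rpow_mul_exp_neg_mul_atTop_nhds_zero m r hr
    have hl2 := (hl n).add (hl (n + 1))
    rw [add_zero] at hl2
    refine squeeze_zero_norm' ?_ hl2
    filter_upwards [eventually_gt_atTop 0] with t ht
    rw [norm_mul, Complex.norm_real, Real.norm_of_nonneg (by positivity)]
    calc u t * ‖((1 + t : ℝ) : ℂ) ^ (1 - s)‖ ≤ u t * (1 + t) :=
          mul_le_mul_of_nonneg_left (hnorm t ht) (by positivity)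
      _ = _ := by simp only [hu]; ring
  have key := integral_Ioi_of_hasDerivAt_of_tendsto' hd (hI1.add (hI2.const_mul _)) hlim
  rw [integral_add hI1 (hI2.const_mul _), integral_const_mul] at key
  have hueq : ∀ t : ℝ, (t : ℂ) ^ n * Complex.exp (-r * t) = (u t : ℂ) := by
    intro t
    simp [hu]
  simp_rw [hueq]
  have key2 : (1 - s) * ∫ t in Set.Ioi (0 : ℝ), (u t : ℂ) * ((1 + t : ℝ) : ℂ) ^ (-s) =
      -(u 0 : ℂ) - ∫ t in Set.Ioi (0 : ℝ), (u' t : ℂ) * ((1 + t : ℝ) : ℂ) ^ (1 - s) := by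
    rw [add_zero, Complex.ofReal_one, Complex.one_cpow, mul_one] at key
    linear_combination key
  rw [key2]
  refine (norm_sub_le _ _).trans (add_le_add ?_ ?_)
  · rw [norm_neg, Complex.norm_real]
  · refine norm_integral_le_of_norm_le hB ?_
    filter_upwards [ae_restrict_mem measurableSet_Ioi] with t ht
    have ht' : (0 : ℝ) < t := ht
    rw [norm_mul, Complex.norm_real, norm_mul (u' t),
      Real.norm_of_nonneg (show 0 ≤ 1 + t by linarith)]
    exact mul_le_mul_of_nonneg_left (hnorm t ht) (norm_nonneg _)

end Decay

/-- The Mellin transform of `z ↦ F(M / z)` for the CDF `F` of a law on `[1, ∞)`. -/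
theorem hasMellin_cdf_div (ν : Measure ℝ) [IsProbabilityMeasure ν] (hν : ∀ᵐ a ∂ν, 1 ≤ a)
    {M : ℝ} (hM : 0 < M) {s : ℂ} (hs : 0 < s.re) :
    HasMellin (fun z => ((cdf ν (M / z) : ℝ) : ℂ)) s
      ((M : ℂ) ^ s * (∫ a, (a : ℂ) ^ (-s) ∂ν) / s) := by
  have hs0 : s ≠ 0 := by rintro rfl; simp at hs
  set f : ℝ × ℝ → ℂ := Set.indicator {p | p.1 * p.2 ≤ M} fun p => (p.1 : ℂ) ^ (s - 1) with hf
  have hset : MeasurableSet {p : ℝ × ℝ | p.1 * p.2 ≤ M} :=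
    measurableSet_le (by fun_prop) (by fun_prop)
  have hfm : Measurable f := Measurable.indicator (by fun_prop) hset
  -- A dominating function independent of `a`: since `a ≥ 1`, the condition `z * a ≤ M` forces `z ≤
  -- M`.
  set g : ℝ → ℝ := Set.indicator (Set.Ioc 0 M) fun z => z ^ (s.re - 1) with hg
  have hgi : Integrable g (volume.restrict (Set.Ioi 0)) := by
    rw [hg, integrable_indicator_iff measurableSet_Ioc, IntegrableOn,
      Measure.restrict_restrict measurableSet_Ioc, Set.inter_eq_left.2 Set.Ioc_subset_Ioi_self,
      ← IntegrableOn, ← intervalIntegrable_iff_integrableOn_Ioc_of_le hM.le]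
    exact intervalIntegral.intervalIntegrable_rpow' (by linarith)
  have hfi : Integrable f ((volume.restrict (Set.Ioi 0)).prod ν) := by
    refine (hgi.comp_fst ν).mono' hfm.aestronglyMeasurable ?_
    filter_upwards [Measure.quasiMeasurePreserving_fst.ae (ae_restrict_mem measurableSet_Ioi),
      Measure.quasiMeasurePreserving_snd.ae hν] with p hp1 hp2
    have hp1' : (0 : ℝ) < p.1 := hp1
    by_cases h : p.1 * p.2 ≤ M
    · have h2 : p.1 ≤ M := (le_mul_of_one_le_right hp1'.le hp2).trans h
      rw [hf, Set.indicator_of_mem (show p ∈ {p : ℝ × ℝ | p.1 * p.2 ≤ M} from h), hg,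
        Set.indicator_of_mem (Set.mem_Ioc.2 ⟨hp1', h2⟩),
        Complex.norm_cpow_eq_rpow_re_of_pos hp1']
      simp
    · rw [hf, Set.indicator_of_notMem (show p ∉ {p : ℝ × ℝ | p.1 * p.2 ≤ M} from h), norm_zero]
      exact Set.indicator_nonneg (fun z hz => Real.rpow_nonneg hz.1.le _) _
  have hinner : ∀ z ∈ Set.Ioi (0 : ℝ),
      ∫ a, f (z, a) ∂ν = (z : ℂ) ^ (s - 1) • ((cdf ν (M / z) : ℝ) : ℂ) := by
    intro z hz
    have hz' : (0 : ℝ) < z := hz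
    have : (fun a => f (z, a)) = Set.indicator (Set.Iic (M / z)) fun _ => (z : ℂ) ^ (s - 1) := by
      funext a
      simp only [hf, Set.indicator, Set.mem_ofPred_eq, Set.mem_Iic, le_div_iff₀ hz', mul_comm]
    rw [this, integral_indicator_const _ measurableSet_Iic, cdf_eq_real, Complex.real_smul,
      smul_eq_mul, mul_comm]
  have houter : ∀ a : ℝ, 1 ≤ a → ∫ z in Set.Ioi (0 : ℝ), f (z, a) =
      (M : ℂ) ^ s * (a : ℂ) ^ (-s) / s := by
    intro a ha
    have ha' : 0 < a := by linarith
    have h1 : ∫ z in Set.Ioi (0 : ℝ), f (z, a) =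
        ∫ z in Set.Ioi (0 : ℝ), (Set.Ioc 0 (M / a)).indicator (fun z : ℝ => (z : ℂ) ^ (s - 1)) z := by
      refine setIntegral_congr_fun measurableSet_Ioi fun z hz => ?_
      have hz' : (0 : ℝ) < z := hz
      simp only [hf, Set.indicator, Set.mem_ofPred_eq, Set.mem_Ioc, le_div_iff₀ ha', hz', true_and]
    rw [h1, setIntegral_indicator measurableSet_Ioc,
      Set.inter_eq_right.2 Set.Ioc_subset_Ioi_self,
      ← intervalIntegral.integral_of_le (by positivity), integral_cpow (Or.inl (by simpa using hs)),
      sub_add_cancel, Complex.ofReal_zero, Complex.zero_cpow hs0, sub_zero, div_eq_mul_inv M a,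
      Complex.ofReal_mul, Complex.mul_cpow_ofReal_nonneg hM.le (by positivity), Complex.ofReal_inv,
      Complex.inv_cpow _ _ (by rw [Complex.arg_ofReal_of_nonneg ha'.le]; exact Real.pi_pos.ne),
      Complex.cpow_neg]
  refine ⟨?_, ?_⟩
  · refine hfi.integral_prod_left.congr ?_
    filter_upwards [ae_restrict_mem measurableSet_Ioi] with z hz
    exact hinner z hz
  · rw [mellin, ← setIntegral_congr_fun measurableSet_Ioi hinner,
      integral_integral_swap (f := fun z a => f (z, a)) hfi,
      integral_congr_ae (hν.mono fun a ha => houter a ha), integral_div, integral_const_mul]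

/-- Tricomi's integral is a gamma expectation: the prefactor `A^(-s + n + 1)` with `A = 1 / Ω`
splits into `Ω^s` and the `A^(n + 1)` that, over `n!`, normalises the density. -/
theorem foxXi_eq_integral (n : ℕ) {Ω : ℝ} (hΩ : 0 < Ω) (s : ℂ) :
    foxXi (1 - 0) (-1) (1 / Ω) (1 + n) s =
      (Ω : ℂ) ^ s * ∫ r, ((1 + r : ℝ) : ℂ) ^ (-s) ∂gammaMeasure (1 + n) (1 / Ω) := by
  have hr : 0 < 1 / Ω := one_div_pos.2 hΩ
  have hr0 : ((1 / Ω : ℝ) : ℂ) ≠ 0 := by exact_mod_cast hr.ne'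
  rw [foxXi, if_neg hr.ne', integral_gammaMeasure_one_add_nat n hr, tricomi]
  have h1 : ((1 / Ω : ℝ) : ℂ) ^ (((1 + n : ℝ) : ℂ) + ((1 - 0 : ℝ) : ℂ) + ((-1 : ℝ) : ℂ) * s - 1) =
      (Ω : ℂ) ^ s * ((1 / Ω : ℝ) : ℂ) ^ (n + 1) := by
    rw [show ((1 + n : ℝ) : ℂ) + ((1 - 0 : ℝ) : ℂ) + ((-1 : ℝ) : ℂ) * s - 1 =
        -s + ((n + 1 : ℕ) : ℂ) by push_cast; ring, Complex.cpow_add _ _ hr0, Complex.cpow_natCast,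
      one_div, Complex.ofReal_inv, Complex.inv_cpow_ofReal_nonneg hΩ.le, Complex.cpow_neg, inv_inv]
  have h2 : Complex.Gamma ((1 + n : ℝ) : ℂ) = n.factorial := by
    rw [show ((1 + n : ℝ) : ℂ) = n + 1 by push_cast; ring, Complex.Gamma_nat_eq_factorial]
  rw [h1, h2, mul_assoc, div_eq_mul_inv _ (n.factorial : ℂ), mul_assoc (((1 / Ω : ℝ) : ℂ) ^ (n + 1))]
  congr 3
  refine setIntegral_congr_fun measurableSet_Ioi fun t _ => ?_
  rw [show ((1 + n : ℝ) : ℂ) - 1 = (n : ℂ) by push_cast; ring, Complex.cpow_natCast,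
    show ((1 + n : ℝ) : ℂ) + ((1 - 0 : ℝ) : ℂ) + ((-1 : ℝ) : ℂ) * s - ((1 + n : ℝ) : ℂ) - 1 = -s by
      push_cast; ring]
  push_cast
  ring

theorem norm_integral_cpow_neg_le_one {ν : Measure ℝ} [IsProbabilityMeasure ν] {f : ℝ → ℝ}
    (hf : ∀ᵐ a ∂ν, 1 ≤ f a) {s : ℂ} (hs : 0 ≤ s.re) : ‖∫ a, (f a : ℂ) ^ (-s) ∂ν‖ ≤ 1 := by
  have := norm_integral_le_of_norm_le_const (μ := ν) (C := 1)
    (hf.mono fun a ha => norm_cpow_neg_le_one ha hs)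
  simpa using this

/-- Integration by parts bounds `(1 - s)E`; writing `sE = E - (1 - s)E` with `‖E‖ ≤ 1` trades the
factor `1 - s` for `s`. -/
theorem exists_norm_mul_integral_gammaMeasure_le (n : ℕ) {r : ℝ} (hr : 0 < r) :
    ∃ D : ℝ, 0 ≤ D ∧ ∀ s : ℂ, 0 < s.re →
      ‖s * ∫ x, ((1 + x : ℝ) : ℂ) ^ (-s) ∂gammaMeasure (1 + n) r‖ ≤ D := by
  obtain ⟨D, hD⟩ := exists_norm_one_sub_mul_integral_le n hr
  have := isProbabilityMeasure_gammaMeasure (a := 1 + n) (r := r) (by positivity) hr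
  have hD0 : 0 ≤ D := (norm_nonneg _).trans (hD 1 (by simp))
  refine ⟨1 + ‖(r : ℂ) ^ (n + 1) / n.factorial‖ * D, by positivity, fun s hs => ?_⟩
  have h1 : ‖∫ x, ((1 + x : ℝ) : ℂ) ^ (-s) ∂gammaMeasure (1 + n) r‖ ≤ 1 :=
    norm_integral_cpow_neg_le_one (f := fun x => 1 + x)
      ((ae_gammaMeasure_pos _ _).mono fun x hx => by linarith) hs.le
  have h2 : ‖(1 - s) * ∫ x, ((1 + x : ℝ) : ℂ) ^ (-s) ∂gammaMeasure (1 + n) r‖ ≤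
      ‖(r : ℂ) ^ (n + 1) / n.factorial‖ * D := by
    rw [integral_gammaMeasure_one_add_nat n hr, mul_left_comm, norm_mul]
    exact mul_le_mul_of_nonneg_left (hD s hs) (norm_nonneg _)
  set E := ∫ x, ((1 + x : ℝ) : ℂ) ^ (-s) ∂gammaMeasure (1 + n) r
  calc ‖s * E‖ = ‖E - (1 - s) * E‖ := by ring_nf
    _ ≤ ‖E‖ + ‖(1 - s) * E‖ := norm_sub_le _ _
    _ ≤ _ := add_le_add h1 h2

theorem measurable_ofReal_cpow (w : ℂ) : Measurable fun a : ℝ => (a : ℂ) ^ w := by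
  fun_prop

/-- The transform is at most `M^c D / |s|²` in norm, which is dominated on the line by a multiple of
`1 / (1 + y²)`. -/
theorem verticalIntegrable_mellin_cdf (ν : Measure ℝ) [IsProbabilityMeasure ν]
    (hν : ∀ᵐ a ∂ν, 1 ≤ a) {M : ℝ} (hM : 0 < M) {D : ℝ}
    (hD : ∀ s : ℂ, 0 < s.re → ‖s * ∫ a, (a : ℂ) ^ (-s) ∂ν‖ ≤ D) {c : ℝ} (hc : 0 < c) :
    Complex.VerticalIntegrable (mellin fun z => ((cdf ν (M / z) : ℝ) : ℂ)) c := by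
  have hre : ∀ y : ℝ, (c + y * Complex.I : ℂ).re = c := fun y => by simp
  have hs0 : ∀ y : ℝ, (c + y * Complex.I : ℂ) ≠ 0 := fun y h => by
    have := congrArg Complex.re h
    rw [hre] at this
    simp at this
    linarith
  have hM0 : (M : ℂ) ≠ 0 := by exact_mod_cast hM.ne'
  have hcont : Continuous fun y : ℝ => ∫ a, (a : ℂ) ^ (-(c + y * Complex.I : ℂ)) ∂ν := by
    refine continuous_of_dominated (bound := fun _ => (1 : ℝ))
      (fun y => (measurable_ofReal_cpow _).aestronglyMeasurable) (fun y => ?_) (integrable_const _) ?_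
    · exact hν.mono fun a ha => norm_cpow_neg_le_one ha (by rw [hre]; exact hc.le)
    · refine hν.mono fun a ha => ?_
      have ha0 : (a : ℂ) ≠ 0 := by
        have : a ≠ 0 := by linarith
        exact_mod_cast this
      exact Continuous.const_cpow (by fun_prop) (Or.inl ha0)
  rw [Complex.VerticalIntegrable]
  simp_rw [fun y : ℝ => (hasMellin_cdf_div ν hν hM (s := c + y * Complex.I)
    (by rw [hre]; exact hc)).2]
  have hD0 : 0 ≤ D := (norm_nonneg _).trans (hD 1 (by simp))
  have hbound : Integrable fun y : ℝ => M ^ c * D / min (c ^ 2) 1 * (1 + y ^ 2)⁻¹ :=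
    integrable_inv_one_add_sq.const_mul _
  refine hbound.mono' (Continuous.aestronglyMeasurable ?_) (ae_of_all _ fun y => ?_)
  · exact ((Continuous.const_cpow (by fun_prop) (Or.inl hM0)).mul hcont).div (by fun_prop) hs0
  · have h1 := hD (c + y * Complex.I) (by rw [hre]; exact hc)
    set E := ∫ a, (a : ℂ) ^ (-(c + y * Complex.I : ℂ)) ∂ν
    have hn : ‖(c + y * Complex.I : ℂ)‖ ^ 2 = c ^ 2 + y ^ 2 := by
      rw [Complex.sq_norm, Complex.normSq_apply]
      simp
      ring
    have hnp : 0 < ‖(c + y * Complex.I : ℂ)‖ := norm_pos_iff.2 (hs0 y)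
    have hmin : 0 < min (c ^ 2) 1 := lt_min (by positivity) one_pos
    have hle : min (c ^ 2) 1 * (1 + y ^ 2) ≤ c ^ 2 + y ^ 2 := by
      have h3 := min_le_left (c ^ 2) 1
      have h4 := mul_le_mul_of_nonneg_right (min_le_right (c ^ 2) 1) (sq_nonneg y)
      linarith
    rw [norm_div, norm_mul, Complex.norm_cpow_eq_rpow_re_of_pos hM, hre]
    calc M ^ c * ‖E‖ / ‖(c + y * Complex.I : ℂ)‖
        = M ^ c * ‖(c + y * Complex.I : ℂ) * E‖ / ‖(c + y * Complex.I : ℂ)‖ ^ 2 := by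
          rw [norm_mul]
          field_simp
      _ ≤ M ^ c * D / (min (c ^ 2) 1 * (1 + y ^ 2)) := by
          rw [hn]
          gcongr
      _ = _ := by
          field_simp

/-- The CDF of a law on `[1, ∞)` is its Mellin-Barnes integral. -/
theorem cdf_eq_mellinInv (ν : Measure ℝ) [IsProbabilityMeasure ν] (hν : ∀ᵐ a ∂ν, 1 ≤ a)
    (hac : ν ≪ volume) {M : ℝ} (hM : 0 < M) {c : ℝ} (hc : 0 < c)
    (hv : Complex.VerticalIntegrable (mellin fun z => ((cdf ν (M / z) : ℝ) : ℂ)) c)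
    {x : ℝ} (hx : 0 < x) :
    ((cdf ν x : ℝ) : ℂ) = mellinInv c (mellin fun z => ((cdf ν (M / z) : ℝ) : ℂ)) (M / x) := by
  have hMx : 0 < M / x := div_pos hM hx
  -- Inversion is pointwise at points of continuity; an absolutely continuous law has no atoms, so
  -- the CDF does not jump.
  have hcdf : ContinuousAt (cdf ν) x := by
    rw [(cdf ν).mono.continuousAt_iff_leftLim_eq_rightLim, StieltjesFunction.rightLim_eq,
      ← sub_eq_zero, ← neg_eq_zero, neg_sub]
    have h := (cdf ν).measure_singleton x
    rw [measure_cdf, hac (measure_singleton x)] at h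
    exact le_antisymm (ENNReal.ofReal_eq_zero.1 h.symm)
      (sub_nonneg.2 ((cdf ν).mono.leftLim_le le_rfl))
  have hxx : M / (M / x) = x := by field_simp
  rw [mellinInv_mellin_eq c _ hMx (hasMellin_cdf_div ν hν hM (by simpa using hc)).1 hv, hxx]
  refine Complex.continuous_ofReal.continuousAt.comp ?_
  refine ContinuousAt.comp (g := cdf ν) ?_ (continuousAt_const.div continuousAt_id hMx.ne')
  rwa [hxx]

/-! ### The Fox kernel and the outage event -/

namespace Channel
variable {K : ℕ} (C : Channel K)

theorem integral_cpow_shiftedGammaProd (hC : ∀ k, 0 < C.scale k) (l : Fin K → ℕ) (s : ℂ) :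
    ∫ a, (a : ℂ) ^ (-s) ∂C.shiftedGammaProd l =
      ∏ k, ∫ r, ((1 + r : ℝ) : ℂ) ^ (-s) ∂gammaMeasure (1 + l k) (1 / C.scale k) := by
  have := C.isProbabilityMeasure_gamma hC l
  rw [shiftedGammaProd, integral_map (measurable_prod_one_add K).aemeasurable
      (measurable_ofReal_cpow _).aestronglyMeasurable,
    ← integral_fintype_prod_eq_prod (fun _ (r : ℝ) => ((1 + r : ℝ) : ℂ) ^ (-s))]
  refine integral_congr_ae ((C.ae_pi_gamma_pos hC l).mono fun r hr => ?_)
  exact prod_ofReal_cpow _ _ (fun k => by linarith [hr k]) _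

/-- The lower parameter contributes `Γ(s)` and the last upper one `1 / Γ(s + 1)`, together the `1 /
s` of the Mellin transform; the other factors are the gamma expectations. -/
theorem foxKernel_eq_mellin (hC : ∀ k, 0 < C.scale k) (l : Fin K → ℕ) {s : ℂ} (hs : 0 < s.re) :
    foxKernel 1 K (C.foxUp l) foxLow s =
      mellin (fun z => ((cdf (C.shiftedGammaProd l) ((∏ k, C.scale k) / z) : ℝ) : ℂ)) s := by
  have := C.isProbabilityMeasure_shiftedGammaProd hC l
  have hs0 : s ≠ 0 := by rintro rfl; simp at hs
  have hG : Complex.Gamma s ≠ 0 := Complex.Gamma_ne_zero_of_re_pos hs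
  rw [(hasMellin_cdf_div _ (C.ae_shiftedGammaProd_one_le hC l)
    (Finset.prod_pos fun k _ => hC k) hs).2, C.integral_cpow_shiftedGammaProd hC l s,
    prod_ofReal_cpow _ _ (fun k => (hC k).le), ← Finset.prod_mul_distrib, foxKernel,
    Fin.prod_univ_castSucc (n := K)]
  simp only [foxUp, foxLow, Fin.snoc_castSucc, Fin.snoc_last, Fin.val_castSucc, Fin.is_lt, if_true,
    Fin.val_last, lt_irrefl, if_false, foxXi_eq_integral _ (hC _)]
  simp only [foxXi, Finset.univ_unique, Finset.prod_singleton, Fin.default_eq_zero]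
  simp
  rw [show (1 + 1 + s - 1 : ℂ) = s + 1 by ring, Complex.Gamma_add_one s hs0]
  field_simp

theorem exists_norm_mul_integral_shiftedGammaProd_le (hK : 1 ≤ K) (hC : ∀ k, 0 < C.scale k)
    (l : Fin K → ℕ) : ∃ D : ℝ, ∀ s : ℂ, 0 < s.re →
      ‖s * ∫ a, (a : ℂ) ^ (-s) ∂C.shiftedGammaProd l‖ ≤ D := by
  have := C.isProbabilityMeasure_gamma hC l
  let k₀ : Fin K := ⟨0, hK⟩
  obtain ⟨D, hD0, hD⟩ := exists_norm_mul_integral_gammaMeasure_le (l k₀) (one_div_pos.2 (hC k₀))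
  refine ⟨D, fun s hs => ?_⟩
  rw [C.integral_cpow_shiftedGammaProd hC, ← Finset.mul_prod_erase _ _ (Finset.mem_univ k₀),
    ← mul_assoc, norm_mul, norm_prod]
  refine (mul_le_of_le_one_right (norm_nonneg _) ?_).trans (hD s hs)
  exact Finset.prod_le_one (fun _ _ => norm_nonneg _) fun k _ =>
    norm_integral_cpow_neg_le_one (f := fun x => 1 + x)
      ((ae_gammaMeasure_pos _ _).mono fun x hx => by linarith) hs.le

/-- Only `Γ(s)` has poles in the numerator, all with `re s ≤ 0`. -/
theorem foxSeparates (hC : ∀ k, 0 < C.scale k) (l : Fin K → ℕ) {c : ℝ} (hc : 0 < c) :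
    FoxSeparates 1 K (C.foxUp l) foxLow c := by
  refine ⟨fun j _ _ => by simpa [foxLow] using hc, fun i hi hA => ?_⟩
  have hi' : i = Fin.castSucc ⟨i, hi⟩ := rfl
  rw [hi', foxUp, Fin.snoc_castSucc] at hA
  exact absurd hA (one_div_pos.2 (hC _)).ne'

/-- Outage is a strict inequality and the CDF a weak one; they agree because `G` has no atoms. -/
theorem outage_eq_cdf (hP : ∀ k, 0 < C.P k) {S : Type*} [MeasurableSpace S] (μ : Measure S)
    [IsProbabilityMeasure μ] (α : Fin (K + 1) → S → ℂ) (hG : AEMeasurable (C.G α) μ)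
    (hac : μ.map (C.G α) ≪ volume) (R : ℝ) :
    C.outage α μ R = cdf (μ.map (C.G α)) (2 ^ R) := by
  have := Measure.isProbabilityMeasure_map hG
  have hpos : ∀ ω k, 0 < 1 + C.snr α k ω := fun ω k => by
    have : 0 ≤ C.snr α k ω := mul_nonneg (hP k).le (sq_nonneg _)
    linarith
  have hset : {ω | C.info α ω < R} = C.G α ⁻¹' Set.Iio (2 ^ R) := by
    ext ω
    have : C.info α ω = Real.logb 2 (C.G α ω) := by
      rw [info, G, Real.logb_prod _ _ fun k _ => (hpos ω k).ne']
    rw [Set.mem_ofPred_eq, this]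
    exact Real.logb_lt_iff_lt_rpow one_lt_two (Finset.prod_pos fun k _ => hpos ω k)
  rw [outage, hset, ← map_measureReal_apply_of_aemeasurable hG measurableSet_Iio, cdf_eq_real,
    measureReal_def, measureReal_def, ← Set.Iio_union_right,
    measure_union _ (measurableSet_singleton _),
    hac (measure_singleton _), add_zero]
  simp

end Channel
end HarqIR

/-! ### Assembly -/

theorem corollary1 {K : ℕ} (hK : 1 ≤ K) (C : HarqIR.Channel K)
    (hP : ∀ k, 0 < C.P k) (hσ : ∀ k, 0 < C.σ k)
    (hρ : |C.ρ| < 1) (hδ : 0 < C.δ) (hρδ : 0 ≤ C.ρ ∨ ∃ d : ℕ, C.δ = d)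
    {S : Type*} [MeasurableSpace S] (μ : MeasureTheory.Measure S)
    [MeasureTheory.IsProbabilityMeasure μ]
    (α : Fin (K + 1) → S → ℂ)
    (hα : ∀ i, ProbabilityTheory.HasLaw (α i) HarqIR.stdComplexNormal μ)
    (hind : ProbabilityTheory.iIndepFun α μ) :
    -- the weights are the probabilities of a distribution on `ℕ^K`
    ((∀ l, 0 ≤ C.weight l) ∧ HasSum C.weight 1) ∧
    -- `F_G(x) = ∫_0^x f_G(t) dt`, with `f_G` the density of `G`
    (μ.map (C.G α)) ≪ MeasureTheory.volume ∧
    (∀ x : ℝ, ProbabilityTheory.cdf (μ.map (C.G α)) x =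
      ∫ t in (0 : ℝ)..x, HarqIR.density (μ.map (C.G α)) t) ∧
    -- `F_{A_l}(x) = ∫_0^x f_{A_l}(t) dt`, with `f_{A_l}` the density of `A_l`
    (∀ l, C.shiftedGammaProd l ≪ MeasureTheory.volume ∧
      ∀ x : ℝ, ProbabilityTheory.cdf (C.shiftedGammaProd l) x =
        ∫ t in (0 : ℝ)..x, HarqIR.density (C.shiftedGammaProd l) t) ∧
    -- `F_G(x) = ∑_l W_l F_{A_l}(x)`
    (∀ x : ℝ, HasSum (fun l => C.weight l * ProbabilityTheory.cdf (C.shiftedGammaProd l) x)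
      (ProbabilityTheory.cdf (μ.map (C.G α)) x)) ∧
    -- `F_{A_l}(x)` as a generalized Fox H-function `Y^{1,K}_{K+1,1}`
    (∀ l, ∀ c : ℝ, 0 < c →
      HarqIR.FoxSeparates 1 K (C.foxUp l) HarqIR.Channel.foxLow c ∧
      Complex.VerticalIntegrable
        (HarqIR.foxKernel 1 K (C.foxUp l) HarqIR.Channel.foxLow) c ∧
      ∀ x : ℝ, 0 < x →
        ((ProbabilityTheory.cdf (C.shiftedGammaProd l) x : ℝ) : ℂ) =
          HarqIR.foxY c 1 K (C.foxUp l) HarqIR.Channel.foxLow ((∏ k, C.scale k) / x)) ∧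
    -- `p_out,K = F_G(2^R) = ∑_l W_l F_{A_l}(2^R)`
    (∀ R : ℝ, C.outage α μ R = ProbabilityTheory.cdf (μ.map (C.G α)) (2 ^ R) ∧
      HasSum (fun l => C.weight l * ProbabilityTheory.cdf (C.shiftedGammaProd l) (2 ^ R))
        (C.outage α μ R)) := by
  open MeasureTheory ProbabilityTheory HarqIR in
  have hC := C.scale_pos hP hσ hρ hδ
  have hq := C.odds_nonneg hρ hδ hρδ
  have hw := C.weight_nonneg hq
  have hA := C.isProbabilityMeasure_shiftedGammaProd hC
  have hone := C.ae_shiftedGammaProd_one_le hC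
  have hAac := C.shiftedGammaProd_absolutelyContinuous hK hC
  have hmap := C.map_G_eq_sum hC hq hρ hδ hρδ μ α hα hind
  have hG : AEMeasurable (C.G α) μ := by
    have := fun i => (hα i).aemeasurable
    unfold Channel.G Channel.snr Channel.coeff
    fun_prop
  have := Measure.isProbabilityMeasure_map hG
  have hGac : μ.map (C.G α) ≪ volume := by
    rw [hmap]
    exact Measure.absolutelyContinuous_sum_left fun l => (hAac l).smul_left _
  -- The mixture identity in real form: half-lines give the CDF series, the whole line gives total
  -- weight `1`.
  have hmix : ∀ s, MeasurableSet s → HasSum (fun l => C.weight l * (C.shiftedGammaProd l).real s)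
      ((μ.map (C.G α)).real s) := by
    intro s hs
    have h : μ.map (C.G α) s = ∑' l, ENNReal.ofReal (C.weight l) * C.shiftedGammaProd l s := by
      rw [hmap, Measure.sum_apply _ hs]
      rfl
    have h2 := ENNReal.hasSum_toReal (h ▸ measure_ne_top (μ.map (C.G α)) s)
    rw [← ENNReal.tsum_toReal_eq fun l => ENNReal.mul_ne_top ENNReal.ofReal_ne_top
      (measure_ne_top _ _), ← h] at h2
    simpa [measureReal_def, ENNReal.toReal_mul, ENNReal.toReal_ofReal (hw _)] using h2
  have hzero : ∀ l, C.shiftedGammaProd l (Set.Iic 0) = 0 := fun l =>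
    measure_eq_zero_iff_ae_notMem.2 ((hone l).mono fun x h (hx : x ≤ 0) => by linarith)
  have hGzero : μ.map (C.G α) (Set.Iic 0) = 0 := by
    rw [hmap, Measure.sum_apply _ measurableSet_Iic]
    simp [hzero]
  have hcdf : ∀ x : ℝ, HasSum (fun l => C.weight l * cdf (C.shiftedGammaProd l) x)
      (cdf (μ.map (C.G α)) x) := by
    intro x
    simp_rw [cdf_eq_real]
    exact hmix _ measurableSet_Iic
  have hM : 0 < ∏ k, C.scale k := Finset.prod_pos fun k _ => hC k
  refine ⟨⟨hw, ?_⟩, hGac, cdf_eq_integral_density _ hGac hGzero,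
    fun l => ⟨hAac l, cdf_eq_integral_density _ (hAac l) (hzero l)⟩, hcdf, fun l c hc => ?_,
    fun R => ?_⟩
  · simpa using hmix _ MeasurableSet.univ
  · obtain ⟨D, hD⟩ := C.exists_norm_mul_integral_shiftedGammaProd_le hK hC l
    have hv := verticalIntegrable_mellin_cdf _ (hone l) hM hD hc
    -- Both integrability and `mellinInv` see the kernel only on the line, where `re s = c > 0`.
    have hker : ∀ y : ℝ, foxKernel 1 K (C.foxUp l) Channel.foxLow (c + y * Complex.I) =
        mellin (fun z => ((cdf (C.shiftedGammaProd l) ((∏ k, C.scale k) / z) : ℝ) : ℂ))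
          (c + y * Complex.I) := fun y => C.foxKernel_eq_mellin hC l (by simpa using hc)
    refine ⟨C.foxSeparates hC l hc, ?_, fun x hx => ?_⟩
    · unfold Complex.VerticalIntegrable at hv ⊢
      simpa only [hker] using hv
    · rw [cdf_eq_mellinInv _ (hone l) (hAac l) hM hc hv hx, foxY]
      simp only [mellinInv, hker]
  · have h := C.outage_eq_cdf hP μ α hG hGac R
    exact ⟨h, h ▸ hcdf _⟩
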